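/- Let $G$ be an m-graph: a finite causal graph (an acyclic directed graph that may also have bidirected edges, which stand for unobserved common causes) whose nodes are the observable variables $V = V_o \cup V_m$ and one binary missingness indicator $R_v$ for each partially observed variable $v \in V_m$ ($R_v = 1$ if $v$ is observed, $R_v=0$ if it is missing), where no indicator is a parent of a variable in $V$. Let $X, Y, Z \subseteq V$ be pairwise disjoint, let $W = V_m \cap (X \cup Y \cup Z)$ and $R_W = \{R_v : v \in W\}$. Every node counts as a descendant of itself. A path from $X$ to $Y$ is proper if it meets $X$ only in its first node, and causal if all its edges are directed and point towards its end. A path is blocked by a set $C$ of nodes if one of its interior nodes is a non-collider that lies in $C$, or a collider without a descendant in $C$; two sets of nodes are d-separated by $C$ if $C$ blocks every path between them. Suppose that (a) $Z$ satisfies the adjustment criterion relative to $(X, Y)$ in $G$: no element of $Z$ is a descendant, in the graph $G_{\overline{X}}$ obtained from $G$ by deleting all edges with an arrowhead at a node of $X$, of a node outside $X$ that lies on a proper causal path from $X$ to $Y$; and every proper non-causal path from $X$ to $Y$ in $G$ is blocked by $Z$; (b) $Y$ is d-separated from $R_W$ given $X \cup Z$; (c) $Z$ is d-separated from $R_W$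 (given the empty set). Then $Z$ is an m-adjustment set for estimating the causal effect of $X$ on $Y$; that is, for every structural causal model compatible with $G$ whose variables have finite or countable domains, and for all values $x$ of $X$ and $y$ of $Y$, $$P(y \mid do(x)) = \sum_{z} P(y \mid x, z, R_W = 1)\, P(z \mid R_W = 1),$$ whenever the right-hand side is defined, i.e. $P(R_W = 1) > 0$, and $P(x, z, R_W = 1) > 0$ for every value $z$ of $Z$ with $P(z, R_W = 1) > 0$. Here a structural causal model compatible with $G$ has mutually independent unobserved variables, each node of $G$ is a function of its parents in $G$ and of some unobserved variables, and two different nodes may depend on a common unobserved variable only if they are joined by a bidirected edge. -/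

import Mathlib

open MeasureTheory
open scoped ENNReal

universe u v w

/-- A causal graph on the nodes `N`: an acyclic directed graph together with bidirected edges, where
`bi.Adj a b` stands for the dashed edge `a ↔ b` (an unobserved common cause of `a` and `b`). A
directed and a bidirected edge may join the same two nodes. -/
structure CausalGraph (N : Type u) where
  /-- `dir a b` is the directed edge `a → b`. -/
  dir : N → N → Prop
  acyclic : ∀ a, ¬ Relation.TransGen dir a a
  bi : SimpleGraph N

/-- The three ways in which an edge can be traversed from `a` to `b`:
`fwd` is `a → b`, `bwd` is `a ← b`, `bid` is `a ↔ b`. -/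
inductive EdgeKind : Type
  | fwd : EdgeKind
  | bwd : EdgeKind
  | bid : EdgeKind

/-- The edge has an arrowhead at the node where its traversal ends. -/
def EdgeKind.HeadAtEnd : EdgeKind → Prop
  | EdgeKind.fwd => True
  | EdgeKind.bwd => False
  | EdgeKind.bid => True

/-- The edge has an arrowhead at the node where its traversal starts. -/
def EdgeKind.HeadAtStart : EdgeKind → Prop
  | EdgeKind.fwd => False
  | EdgeKind.bwd => True
  | EdgeKind.bid => True

namespace CausalGraph

variable {N : Type u}

/-- `b` is a descendant of `a`; every node is a descendant of itself. -/
def IsDescendant (G : CausalGraph N) (a b : N) : Prop :=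
  Relation.ReflTransGen G.dir a b

/-- The graph has an edge that is traversed from `a` to `b` in the given way. -/
def Edge (G : CausalGraph N) : EdgeKind → N → N → Prop
  | EdgeKind.fwd, a, b => G.dir a b
  | EdgeKind.bwd, a, b => G.dir b a
  | EdgeKind.bid, a, b => G.bi.Adj a b

/-- The graph obtained by deleting all edges with an arrowhead at a node of `X`. -/
def deleteIncoming (G : CausalGraph N) (X : Set N) : CausalGraph N where
  dir a b := G.dir a b ∧ b ∉ X
  acyclic a h := G.acyclic a (Relation.TransGen.mono (fun _ _ hab => hab.1) _ _ h)
  bi :=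
    { Adj := fun a b => G.bi.Adj a b ∧ a ∉ X ∧ b ∉ X
      symm := ⟨fun _ _ h => ⟨h.1.symm, h.2.2, h.2.1⟩⟩
      loopless := ⟨fun a h => G.bi.loopless.irrefl a h.1⟩ }

/-- Walks: finite sequences of consecutive edges, each traversed in either direction. -/
inductive Walk (G : CausalGraph N) : N → N → Type u
  | nil (a : N) : Walk G a a
  | cons {a b c : N} (k : EdgeKind) (h : G.Edge k a b) (p : Walk G b c) : Walk G a c

namespace Walk

variable {G : CausalGraph N}

/-- The nodes of a walk other than its first node, in order. -/
def tailNodes : {a b : N} → G.Walk a b → List N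
  | _, _, nil _ => []
  | _, _, @cons _ _ _ b _ _ _ p => b :: p.tailNodes

/-- The nodes of a walk, in order. -/
def nodes {a b : N} (p : G.Walk a b) : List N :=
  a :: p.tailNodes

/-- A path is a walk that does not repeat a node. -/
def IsPath {a b : N} (p : G.Walk a b) : Prop :=
  p.nodes.Nodup

/-- All edges are directed and traversed forwards. -/
def IsCausal : {a b : N} → G.Walk a b → Prop
  | _, _, nil _ => True
  | _, _, cons k _ p => k = EdgeKind.fwd ∧ p.IsCausal

/-- The walk does not meet `X` after its first node. -/
def IsProper (X : Set N) {a b : N} (p : G.Walk a b) : Prop :=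
  ∀ n ∈ p.tailNodes, n ∉ X

/-- No interior node blocks the walk given `C`: each interior collider has a descendant
(possibly itself) in `C`, and no other interior node is in `C`. -/
def IsOpen (C : Set N) : {a b : N} → G.Walk a b → Prop
  | _, _, nil _ => True
  | _, _, cons _ _ (nil _) => True
  | _, _, cons k₁ _ (@cons _ _ m _ _ k₂ h₂ p) =>
      ((k₁.HeadAtEnd ∧ k₂.HeadAtStart) → ∃ d ∈ C, G.IsDescendant m d) ∧
      (¬ (k₁.HeadAtEnd ∧ k₂.HeadAtStart) → m ∉ C) ∧
      (cons k₂ h₂ p).IsOpen C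

end Walk

/-- `A` and `B` are d-separated by `C`: every path between them is blocked by `C`. -/
def DSep (G : CausalGraph N) (A B C : Set N) : Prop :=
  ∀ a ∈ A, ∀ b ∈ B, ∀ p : G.Walk a b, p.IsPath → ¬ p.IsOpen C

/-- `n` lies on a proper causal path from `X` to `Y`. -/
def OnProperCausalPath (G : CausalGraph N) (X Y : Set N) (n : N) : Prop :=
  ∃ a ∈ X, ∃ b ∈ Y, ∃ p : G.Walk a b, p.IsPath ∧ p.IsCausal ∧ p.IsProper X ∧ n ∈ p.nodes

/-- The adjustment criterion for `Z` relative to `(X, Y)`. -/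
def AdjustmentCriterion (G : CausalGraph N) (X Y Z : Set N) : Prop :=
  (∀ n, n ∉ X → G.OnProperCausalPath X Y n →
    ∀ z ∈ Z, ¬ (G.deleteIncoming X).IsDescendant n z) ∧
  (∀ a ∈ X, ∀ b ∈ Y, ∀ p : G.Walk a b,
    p.IsPath → p.IsProper X → ¬ p.IsCausal → ¬ p.IsOpen Z)

theorem wellFounded_dir [Finite N] (G : CausalGraph N) : WellFounded G.dir := by
  have : IsTrans N (Relation.TransGen G.dir) := ⟨fun _ _ _ h₁ h₂ => h₁.trans h₂⟩
  have : Std.Irrefl (Relation.TransGen G.dir) := ⟨G.acyclic⟩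
  exact Subrelation.wf (fun h => Relation.TransGen.single h)
    (Finite.wellFounded_of_trans_of_irrefl (Relation.TransGen G.dir))

end CausalGraph

/-- A structural causal model compatible with the causal graph `G`, with endogenous variables
valued in `D`. The exogenous variables are indexed by the finite type `K`; they are mutually
independent, with laws `μ k` on arbitrary measurable spaces. Each endogenous variable `i` is a
function of its parents in `G` and of the exogenous variables in `uses i`, and two different
endogenous variables may share an exogenous variable only if they are joined by a bidirected
edge. -/
structure SCM {N : Type u} (G : CausalGraph N) (D : N → Type v) where
  K : Type
  fintypeK : Fintype K
  Ω : K → Type w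
  measurableSpaceΩ : ∀ k, MeasurableSpace (Ω k)
  μ : ∀ k, Measure (Ω k)
  isProbabilityMeasureμ : ∀ k, IsProbabilityMeasure (μ k)
  uses : N → Set K
  shared : ∀ i j k, i ≠ j → k ∈ uses i → k ∈ uses j → G.bi.Adj i j
  f : ∀ i, (∀ j : {j // G.dir j i}, D j) → (∀ k : uses i, Ω k) → D i
  measurable_f : ∀ i pa (a : D i), MeasurableSet {e : ∀ k : uses i, Ω k | f i pa e = a}

attribute [instance] SCM.fintypeK SCM.measurableSpaceΩ SCM.isProbabilityMeasureμ

namespace SCM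

variable {N : Type u} {G : CausalGraph N} {D : N → Type v} [Finite N]

/-- The values of all endogenous variables at the exogenous state `e` under the intervention
`x`: a variable `i` with `x i = some a` is set to `a`, every other one follows its own
mechanism. -/
noncomputable def value (M : SCM.{u, v, w} G D) (x : ∀ i, Option (D i)) (e : ∀ k, M.Ω k) :
    ∀ i, D i :=
  G.wellFounded_dir.fix fun i ih =>
    (x i).getD (M.f i (fun j => ih j.1 j.2) (fun k => e k.1))

/-- The probability of the event `E` under the intervention `x`. -/
noncomputable def probDo (M : SCM.{u, v, w} G D) (x : ∀ i, Option (D i)) (E : Set (∀ i, D i)) :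
    ℝ≥0∞ :=
  Measure.pi M.μ {e | M.value x e ∈ E}

/-- The probability of the event `E` (without intervention). -/
noncomputable def prob (M : SCM.{u, v, w} G D) (E : Set (∀ i, D i)) : ℝ≥0∞ :=
  M.probDo (fun _ => none) E

/-- The conditional probability of `E` given `F` (meaningful if `F` has positive probability). -/
noncomputable def condProb (M : SCM.{u, v, w} G D) (E F : Set (∀ i, D i)) : ℝ≥0∞ :=
  M.prob (E ∩ F) / M.prob F

end SCM

/-- An m-graph over the observable variables `V`, of which those in `Vm` may be missing: a causal
graph on `V` and the missingness indicators `R_v` for `v ∈ Vm`, in which no indicator is a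
parent of a variable in `V`. The node `Sum.inl v` is the variable `v`, and `Sum.inr v` is `R_v`. -/
structure MGraph (V : Type u) (Vm : Set V) extends CausalGraph (V ⊕ Vm) where
  indicator_not_parent : ∀ (r : Vm) (v : V), ¬ dir (Sum.inr r) (Sum.inl v)

/-- The domains of the nodes of an m-graph: `D v` for the variable `v`, and `Bool` for each
missingness indicator, where `true` is the value 1 (observed). -/
def MVal {V : Type u} (Vm : Set V) (D : V → Type) : V ⊕ Vm → Type
  | Sum.inl v => D v
  | Sum.inr _ => Bool

namespace MGraph

variable {V : Type u} {Vm : Set V}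

/-- The set of nodes of the variables in `A`. -/
def varNodes (Vm : Set V) (A : Set V) : Set (V ⊕ Vm) :=
  {n | ∃ v ∈ A, n = Sum.inl v}

/-- The set of nodes `R_W`, for a set `W` of variables that may be missing. -/
def indNodes (Vm : Set V) (W : Set V) : Set (V ⊕ Vm) :=
  {n | ∃ r : Vm, r.1 ∈ W ∧ n = Sum.inr r}

/-- The event that the variables in `A` have the values `a`. -/
def varEvent (Vm : Set V) {D : V → Type} {A : Set V} (a : ∀ i : A, D i) :
    Set (∀ n, MVal Vm D n) :=
  {s | ∀ i : A, s (Sum.inl i.1) = a i}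

/-- The event `R_W = 1`. -/
def indEvent (Vm : Set V) (D : V → Type) (W : Set V) : Set (∀ n, MVal Vm D n) :=
  {s | ∀ r : Vm, r.1 ∈ W → s (Sum.inr r) = true}

open Classical in
/-- The intervention `do(x)` that sets the variables in `X` to the values `x`. -/
noncomputable def doVar (Vm : Set V) {D : V → Type} {X : Set V} (x : ∀ i : X, D i) :
    ∀ n, Option (MVal Vm D n)
  | Sum.inl v => if h : v ∈ X then some (x ⟨v, h⟩) else none
  | Sum.inr _ => none

/-- `Z` is an m-adjustment set for the causal effect of `X` on `Y`: with `W = Vm ∩ (X ∪ Y ∪ Z)`,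
for every model compatible with `G`, with discrete (finite or countable) domains, and all values
`x` and `y`, one has `P(y | do(x)) = ∑ z, P(y | x, z, R_W = 1) P(z | R_W = 1)` whenever the
right-hand side is defined, that is, `P(R_W = 1) > 0`, and `P(x, z, R_W = 1) > 0` for all `z`
with `P(z, R_W = 1) > 0`. -/
def IsMAdjustmentSet [Finite V] (G : MGraph V Vm) (X Y Z : Set V) : Prop :=
  ∀ (D : V → Type) [∀ i, Countable (D i)] (M : SCM.{u, 0, w} G.toCausalGraph (MVal Vm D))
    (x : ∀ i : X, D i) (y : ∀ i : Y, D i),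
    M.prob (indEvent Vm D (Vm ∩ (X ∪ Y ∪ Z))) ≠ 0 →
    (∀ z : (∀ i : Z, D i),
      M.prob (varEvent Vm z ∩ indEvent Vm D (Vm ∩ (X ∪ Y ∪ Z))) ≠ 0 →
      M.prob (varEvent Vm x ∩ varEvent Vm z ∩ indEvent Vm D (Vm ∩ (X ∪ Y ∪ Z))) ≠ 0) →
    M.probDo (doVar Vm x) (varEvent Vm y) =
      ∑' z : (∀ i : Z, D i),
        M.condProb (varEvent Vm y)
          (varEvent Vm x ∩ varEvent Vm z ∩ indEvent Vm D (Vm ∩ (X ∪ Y ∪ Z))) *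
        M.condProb (varEvent Vm z) (indEvent Vm D (Vm ∩ (X ∪ Y ∪ Z)))

end MGraph

/-! Write Y_x for the value of Y under do(x). Splitting by the observed value of Z gives P(y |
do(x)) = ∑ z, P(Y_x = y, z), and the formula is proved term by term. By (c), P(z | R_W = 1) = P(z).
By (b), P(y | x, z, R_W = 1) = P(y | x, z). What remains, P(Y_x = y, z) P(x, z) = P(x, y, z) P(z),
says that X and Y_x are independent given Z; this is where (a) enters.

All three steps rest on the global Markov property `SCM.prob_mul_prob_of_dSep`. A d-separation cuts
the ancestral set into two parts (`DSep.exists_split`); once C is held fixed, their mechanisms read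
disjoint sets of exogenous variables, so probabilities factor.

For (a), the mechanisms of nodes on proper causal paths are made to read the constant x in place of
their parents in X (`fixBetween`). Under the adjustment criterion this leaves X and Z unchanged and
turns Y into Y_x. The new model lives on the graph without the first edges of proper causal paths,
where Z separates X from Y, so the Markov property applies to it. -/

namespace CausalGraph

variable {N : Type u} {G : CausalGraph N}

/-! ### Walks: openness, prepending edges, removing loops -/

theorem Edge.ne {k : EdgeKind} {a b : N} (h : G.Edge k a b) : a ≠ b := by
  rintro rfl
  cases k
  · exact G.acyclic a (Relation.TransGen.single h)
  · exact G.acyclic a (Relation.TransGen.single h)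
  · exact G.bi.loopless.irrefl a h

namespace Walk

/-- The first edge of the walk, if there is one, has an arrowhead at the first node. -/
def HeadAtFirst : {a b : N} → G.Walk a b → Prop
  -- With this convention every node of the target set reaches it by an admissible walk, even if it
  -- is conditioned on.
  | _, _, nil _ => True
  | _, _, cons k _ _ => k.HeadAtStart

theorem mem_nodes_cons {a b c n : N} {k : EdgeKind} {h : G.Edge k a b} {p : G.Walk b c} :
    n ∈ (cons k h p).nodes ↔ n = a ∨ n ∈ p.nodes := by
  simp [nodes, tailNodes]

theorem start_mem_nodes {a b : N} (p : G.Walk a b) : a ∈ p.nodes := by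
  simp [nodes]

theorem isPath_nil (a : N) : (nil a : G.Walk a a).IsPath := by
  simp [IsPath, nodes, tailNodes]

theorem isPath_cons {a b c : N} {k : EdgeKind} {h : G.Edge k a b} {p : G.Walk b c} :
    (cons k h p).IsPath ↔ a ∉ p.nodes ∧ p.IsPath := by
  simp [IsPath, nodes, tailNodes]

theorem IsOpen.tail {C : Set N} {a b c : N} {k : EdgeKind} {h : G.Edge k a b} {p : G.Walk b c}
    (hp : (cons k h p).IsOpen C) : p.IsOpen C := by
  cases p with
  | nil => trivial
  | cons k₂ h₂ p => exact hp.2.2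

theorem IsOpen.head_of_mem {C : Set N} {a b c : N} {k : EdgeKind} {h : G.Edge k a b}
    {p : G.Walk b c} (hp : (cons k h p).IsOpen C) (hb : b ∈ C) : p.HeadAtFirst := by
  cases p with
  | nil => trivial
  | cons k₂ h₂ p =>
    by_contra hn
    exact hp.2.1 (fun hk => hn hk.2) hb

theorem IsOpen.cons {C : Set N} {a b c : N} {k : EdgeKind} {p : G.Walk b c} (hp : p.IsOpen C)
    (h : G.Edge k a b) (h₁ : k.HeadAtEnd → p.HeadAtFirst → ∃ d ∈ C, G.IsDescendant b d)
    (h₂ : b ∈ C → k.HeadAtEnd ∧ p.HeadAtFirst) : (Walk.cons k h p).IsOpen C := by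
  cases p with
  | nil => trivial
  | cons k₂ h₃ p => exact ⟨fun hk => h₁ hk.1 hk.2, fun hk hb => hk (h₂ hb), hp⟩

/-- The final part of a walk, from one of its nodes on. -/
theorem exists_suffix {C : Set N} {n : N} {a b : N} (p : G.Walk a b) (hn : n ∈ p.nodes)
    (hp : p.IsPath) (ho : p.IsOpen C) :
    ∃ q : G.Walk n b, q.IsPath ∧ q.IsOpen C ∧ q.nodes ⊆ p.nodes ∧
      (n ≠ a → n ∈ C → q.HeadAtFirst) := by
  induction p with
  | nil a =>
    obtain rfl : n = a := by simpa [nodes, tailNodes] using hn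
    exact ⟨nil n, isPath_nil n, trivial, fun _ h => h, fun h => (h rfl).elim⟩
  | @cons a m c k h p ih =>
    rcases mem_nodes_cons.1 hn with rfl | hn'
    · exact ⟨cons k h p, hp, ho, fun _ h => h, fun h => (h rfl).elim⟩
    · by_cases hm : n = m
      · subst hm
        exact ⟨p, (isPath_cons.1 hp).2, ho.tail, fun _ hx => mem_nodes_cons.2 (Or.inr hx),
          fun _ hC => ho.head_of_mem hC⟩
      · obtain ⟨q, h₁, h₂, h₃, h₄⟩ := ih hn' (isPath_cons.1 hp).2 ho.tail
        exact ⟨q, h₁, h₂, fun _ hx => mem_nodes_cons.2 (Or.inr (h₃ hx)), fun _ => h₄ hm⟩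

/-- Prepending an edge to an open path, and cutting off the loop if there is one. -/
theorem exists_isPath_cons {C : Set N} {a b c : N} {k : EdgeKind} {h : G.Edge k a b}
    {p : G.Walk b c} (hp : p.IsPath) (ho : (cons k h p).IsOpen C) :
    ∃ q : G.Walk a c, q.IsPath ∧ q.IsOpen C ∧ (∀ n ∈ q.nodes, n = a ∨ n ∈ p.nodes) ∧
      (a ∈ C → k.HeadAtStart → q.HeadAtFirst) := by
  by_cases ha : a ∈ p.nodes
  -- `a` is not the first node of `p`, so if it lies in `C` it is a collider of `p` or its end, and
  -- what follows it keeps the required arrowhead.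
  · obtain ⟨q, h₁, h₂, h₃, h₄⟩ := p.exists_suffix ha hp ho.tail
    exact ⟨q, h₁, h₂, fun _ hx => Or.inr (h₃ hx), fun hC _ => h₄ h.ne hC⟩
  · exact ⟨cons k h p, isPath_cons.2 ⟨ha, hp⟩, ho, fun _ hx => mem_nodes_cons.1 hx,
      fun _ hk => hk⟩

theorem IsCausal.transGen {a b : N} {p : G.Walk a b} (hp : p.IsCausal) :
    ∀ n ∈ p.tailNodes, Relation.TransGen G.dir a n := by
  induction p with
  | nil a => simp [tailNodes]
  | @cons a m c k h p ih =>
    obtain ⟨rfl, hp⟩ := hp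
    intro n hn
    rcases List.mem_cons.1 hn with rfl | hn
    · exact Relation.TransGen.single h
    · exact Relation.TransGen.head h (ih hp n hn)

theorem IsCausal.isPath {a b : N} {p : G.Walk a b} (hp : p.IsCausal) : p.IsPath := by
  induction p with
  | nil a => exact isPath_nil a
  | @cons a m c k h p ih =>
    have := hp.transGen
    exact isPath_cons.2 ⟨fun ha => G.acyclic a (this a ha), ih hp.2⟩

theorem IsCausal.isOpen {C : Set N} {a b : N} {p : G.Walk a b} (hp : p.IsCausal)
    (hC : ∀ n ∈ p.nodes, n ∉ C) : p.IsOpen C := by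
  induction p with
  | nil a => trivial
  | @cons a m c k h p ih =>
    obtain ⟨rfl, hp⟩ := hp
    have hC' : ∀ n ∈ p.nodes, n ∉ C := fun n hn => hC n (mem_nodes_cons.2 (Or.inr hn))
    cases p with
    | nil => trivial
    | cons k₂ h₂ p =>
      obtain ⟨rfl, hp'⟩ := id hp
      exact ⟨fun hk => hk.2.elim, fun _ => hC' _ (start_mem_nodes _), ih hp hC'⟩

/-- Every node reached by directed edges into nodes outside `X` is reached by a proper causal
walk. -/
theorem exists_isCausal {X : Set N} {a b : N}
    (h : Relation.ReflTransGen (G.deleteIncoming X).dir a b) :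
    ∃ p : G.Walk a b, p.IsCausal ∧ p.IsProper X ∧
      ∀ n ∈ p.nodes, Relation.ReflTransGen (G.deleteIncoming X).dir a n := by
  induction h using Relation.ReflTransGen.head_induction_on with
  | refl =>
    refine ⟨nil b, trivial, by simp [IsProper, tailNodes], ?_⟩
    simp only [nodes, tailNodes, List.mem_singleton, forall_eq]
    exact Relation.ReflTransGen.refl
  | @head a m h _ ih =>
    obtain ⟨p, h₁, h₂, h₃⟩ := ih
    refine ⟨cons EdgeKind.fwd h.1 p, ⟨rfl, h₁⟩, ?_, ?_⟩
    · intro n hn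
      rcases List.mem_cons.1 hn with rfl | hn
      · exact h.2
      · exact h₂ n hn
    · intro n hn
      rcases mem_nodes_cons.1 hn with rfl | hn
      · exact Relation.ReflTransGen.refl
      · exact Relation.ReflTransGen.head h (h₃ n hn)

/-- An open path can be extended at its start, against the edges of a directed path that avoids
the ancestors of the conditioning set. -/
theorem exists_isOpen_of_reflTransGen {C : Set N} {s a b : N} {p : G.Walk s b} (hp : p.IsPath)
    (ho : p.IsOpen C) (hs : ¬ ∃ d ∈ C, G.IsDescendant s d) (h : G.IsDescendant s a) :
    ∃ q : G.Walk a b, q.IsPath ∧ q.IsOpen C := by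
  induction h with
  | refl => exact ⟨p, hp, ho⟩
  | @tail m n hm hmn ih =>
    obtain ⟨q, h₁, h₂⟩ := ih
    -- `m` is left against a directed edge, hence is a non-collider; it only has to avoid `C`, as
    -- all descendants of `s` do.
    have hmC : m ∉ C := fun hC => hs ⟨m, hC, hm⟩
    obtain ⟨r, h₃, h₄, -⟩ := exists_isPath_cons (k := EdgeKind.bwd) (h := hmn) h₁
      (h₂.cons (k := EdgeKind.bwd) hmn (fun hk => hk.elim) (fun hC => (hmC hC).elim))
    exact ⟨r, h₃, h₄⟩

end Walk

/-! ### Splitting an ancestral set along a d-separation -/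

/-- The ancestors of the nodes in `S`, including these. -/
def ancestors (G : CausalGraph N) (S : Set N) : Set N :=
  {n | ∃ d ∈ S, G.IsDescendant n d}

theorem subset_ancestors (S : Set N) : S ⊆ G.ancestors S :=
  fun n hn => ⟨n, hn, Relation.ReflTransGen.refl⟩

theorem mem_ancestors_of_dir {S : Set N} {a b : N} (h : G.dir a b) (hb : b ∈ G.ancestors S) :
    a ∈ G.ancestors S := by
  obtain ⟨d, hd, hbd⟩ := hb
  exact ⟨d, hd, Relation.ReflTransGen.head h hbd⟩

/-- There is an open path from `s` to `B` given `C`, which starts with an arrowhead at `s` if `s`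
is in `C`. -/
def OpenTo (G : CausalGraph N) (B C : Set N) (s : N) : Prop :=
  ∃ b ∈ B, ∃ p : G.Walk s b, p.IsPath ∧ p.IsOpen C ∧ (s ∈ C → p.HeadAtFirst)

/-- Prepending the edge can fail only if `m` becomes a collider without descendants in `C`. As `m`
is ancestral, it then has a descendant in `A` or `B`. The first would yield an open path from `A` to
`B`; in the second case the walk is rerouted along the directed path from `m` down to `B`. -/
theorem DSep.openTo_of_edge {A B C : Set N} (hd : G.DSep A B C) {k : EdgeKind} {s m : N}
    (h : G.Edge k s m) (hm : m ∈ G.ancestors (A ∪ B ∪ C)) (hmC : m ∈ C → k.HeadAtEnd)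
    (hsC : s ∈ C → k.HeadAtStart) (ho : G.OpenTo B C m) : G.OpenTo B C s := by
  obtain ⟨b, hb, p, hp, hpo, hph⟩ := ho
  have key : ∃ b ∈ B, ∃ p : G.Walk m b, p.IsPath ∧ (Walk.cons k h p).IsOpen C := by
    by_cases hC : ∃ d ∈ C, G.IsDescendant m d
    · exact ⟨b, hb, p, hp, hpo.cons h (fun _ _ => hC) (fun hc => ⟨hmC hc, hph hc⟩)⟩
    · obtain ⟨d, (hdA | hdB) | hdC, hmd⟩ := hm
      · obtain ⟨q, h₁, h₂⟩ := Walk.exists_isOpen_of_reflTransGen hp hpo hC hmd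
        exact (hd d hdA b hb q h₁ h₂).elim
      · have hmd' : Relation.ReflTransGen (G.deleteIncoming ∅).dir m d :=
          Relation.ReflTransGen.mono (fun _ _ hab => ⟨hab, id⟩) _ _ hmd
        obtain ⟨q, h₁, -, h₃⟩ := Walk.exists_isCausal hmd'
        have h₄ : ∀ n ∈ q.nodes, n ∉ C := fun n hn hnC =>
          hC ⟨n, hnC, Relation.ReflTransGen.mono (fun _ _ hab => hab.1) _ _ (h₃ n hn)⟩
        refine ⟨d, hdB, q, h₁.isPath, ?_⟩
        have h₅ := h₁.isOpen h₄
        cases q with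
        | nil => trivial
        | cons k₂ h₂ q =>
          obtain ⟨rfl, -⟩ := h₁
          exact h₅.cons h (fun _ hh => hh.elim) (fun hc => (h₄ _ (Walk.start_mem_nodes _) hc).elim)
      · exact (hC ⟨d, hdC, hmd⟩).elim
  obtain ⟨b, hb, p, hp, hpo⟩ := key
  obtain ⟨q, h₁, h₂, -, h₄⟩ := Walk.exists_isPath_cons hp hpo
  exact ⟨b, hb, q, h₁, h₂, fun hc => h₄ hc (hsC hc)⟩

/-- A d-separation splits the ancestral set of the three sets into two parts that are joined by
no bidirected edge, and by directed edges only out of the separating set. -/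
theorem DSep.exists_split {A B C : Set N} (hd : G.DSep A B C) :
    ∃ T : Set N, B ⊆ T ∧ Disjoint A T ∧
      (∀ i ∈ G.ancestors (A ∪ B ∪ C), ∀ j ∈ G.ancestors (A ∪ B ∪ C), G.bi.Adj i j →
        (i ∈ T ↔ j ∈ T)) ∧
      (∀ i j, G.dir i j → j ∈ G.ancestors (A ∪ B ∪ C) → i ∉ C → (i ∈ T ↔ j ∈ T)) := by
  -- The arrowhead demanded at nodes of `C` places such a node on the side of its incoming edges,
  -- that is, of its mechanism; its outgoing edges may cross.
  refine ⟨{s | G.OpenTo B C s}, ?_, ?_, ?_, ?_⟩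
  · exact fun b hb => ⟨b, hb, Walk.nil b, Walk.isPath_nil b, trivial, fun _ => trivial⟩
  · rw [Set.disjoint_left]
    rintro a ha ⟨b, hb, p, hp, ho, -⟩
    exact hd a ha b hb p hp ho
  · intro i hi j hj hij
    exact ⟨hd.openTo_of_edge (k := EdgeKind.bid) hij.symm hi (fun _ => trivial) (fun _ => trivial),
      hd.openTo_of_edge (k := EdgeKind.bid) hij hj (fun _ => trivial) (fun _ => trivial)⟩
  · intro i j hij hj hi
    exact ⟨hd.openTo_of_edge (k := EdgeKind.bwd) hij (mem_ancestors_of_dir hij hj)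
        (fun h => (hi h).elim) (fun _ => trivial),
      hd.openTo_of_edge (k := EdgeKind.fwd) hij hj (fun _ => trivial) (fun h => (hi h).elim)⟩

end CausalGraph

/-! ### Independence in a product measure -/

/-- Two events that depend on disjoint sets of coordinates are independent for a product measure. -/
theorem MeasureTheory.Measure.pi_inter_of_dependsOn_compl {K : Type*} [Fintype K] {Ω : K → Type*}
    [∀ k, MeasurableSpace (Ω k)] (μ : ∀ k, Measure (Ω k)) [∀ k, IsProbabilityMeasure (μ k)]
    (S : Set K) {E F : Set (∀ k, Ω k)} (hE : MeasurableSet E) (hF : MeasurableSet F)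
    (hES : ∀ e e', (∀ k ∈ S, e k = e' k) → (e ∈ E ↔ e' ∈ E))
    (hFS : ∀ e e', (∀ k ∉ S, e k = e' k) → (e ∈ F ↔ e' ∈ F)) :
    Measure.pi μ (E ∩ F) = Measure.pi μ E * Measure.pi μ F := by
  classical
  have hne : ∀ k, Nonempty (Ω k) := fun k => nonempty_of_isProbabilityMeasure (μ k)
  let e₀ : ∀ k, Ω k := fun k => (hne k).some
  let I : Finset K := Finset.univ.filter (· ∈ S)
  let J : Finset K := Finset.univ.filter (· ∉ S)
  have hIJ : Disjoint I J := Finset.disjoint_filter_filter_not _ _ _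
  have hind := (ProbabilityTheory.iIndepFun_pi (μ := μ) (X := fun k (a : Ω k) => a)
    (fun k => aemeasurable_id)).indepFun_finset I J hIJ (fun k => measurable_pi_apply k)
  have extend : ∀ (L : Finset K) (E : Set (∀ k, Ω k)), MeasurableSet E →
      (∀ e e', (∀ k ∈ L, e k = e' k) → (e ∈ E ↔ e' ∈ E)) →
      ∃ E' : Set (∀ k : L, Ω k), MeasurableSet E' ∧ E = (fun e (k : L) => e k) ⁻¹' E' := by
    intro L E hE hL
    -- Coordinates outside `L` are filled with the default `e₀`, on which membership in `E` does not
    -- depend.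
    refine ⟨(fun (a : ∀ k : L, Ω k) k => if h : k ∈ L then a ⟨k, h⟩ else e₀ k) ⁻¹' E, ?_, ?_⟩
    · refine measurableSet_preimage (measurable_pi_lambda _ fun k => ?_) hE
      by_cases h : k ∈ L
      · simpa [h] using measurable_pi_apply _
      · simp [h]
    · ext e
      exact hL _ _ fun k hk => by simp [hk]
  obtain ⟨E', hE', rfl⟩ := extend I E hE fun e e' h => hES e e' fun k hk => h k (by simp [I, hk])
  obtain ⟨F', hF', rfl⟩ := extend J F hF fun e e' h => hFS e e' fun k hk => h k (by simp [J, hk])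
  exact hind.measure_inter_preimage_eq_mul _ _ hE' hF'

/-! ### Structural causal models and the global Markov property -/

namespace SCM

variable {N : Type u} {G : CausalGraph N} {D : N → Type v}

/-- The assignments that agree with `s` on `S`. -/
def agree (S : Set N) (s : ∀ i, D i) : Set (∀ i, D i) :=
  {t | ∀ i ∈ S, t i = s i}

theorem agree_union (S T : Set N) (s : ∀ i, D i) : agree (S ∪ T) s = agree S s ∩ agree T s := by
  ext t
  simp only [agree, Set.mem_union, Set.mem_ofPred_eq, Set.mem_inter_iff]
  exact ⟨fun h => ⟨fun i hi => h i (Or.inl hi), fun i hi => h i (Or.inr hi)⟩,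
    fun h i hi => hi.elim (h.1 i) (h.2 i)⟩

variable [Finite N]

theorem value_eq (M : SCM.{u, v, w} G D) (x : ∀ i, Option (D i)) (e : ∀ k, M.Ω k) (i : N) :
    M.value x e i = (x i).getD (M.f i (fun j => M.value x e j.1) (fun k => e k.1)) := by
  unfold value
  rw [WellFounded.fix_eq]

/-- A variable that already has the value to which an intervention sets it is unaffected by it. -/
theorem value_eq_of_consistent (M : SCM.{u, v, w} G D) (x : ∀ i, Option (D i)) (e : ∀ k, M.Ω k)
    (h : ∀ i a, x i = some a → M.value (fun _ => none) e i = a) :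
    M.value x e = M.value (fun _ => none) e := by
  funext i
  induction i using G.wellFounded_dir.induction with
  | _ i ih =>
    cases hx : x i with
    | some a => rw [h i a hx, value_eq, hx]; rfl
    | none =>
      rw [value_eq, value_eq, hx]
      have : (fun j : {j // G.dir j i} => M.value x e j.1) =
          fun j : {j // G.dir j i} => M.value (fun _ => none) e j.1 := funext fun j => ih j.1 j.2
      rw [this]

/-- The value that the mechanism of `i` yields under the intervention `x` on the other variables. -/
noncomputable def mechanism (M : SCM.{u, v, w} G D) (x : ∀ i, Option (D i)) (e : ∀ k, M.Ω k)
    (i : N) : D i :=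
  M.f i (fun j => M.value x e j.1) (fun k => e k.1)

theorem measurableSet_mechanism_of_value [∀ i, Countable (D i)] (M : SCM.{u, v, w} G D)
    (x : ∀ i, Option (D i)) (i : N) (a : D i)
    (h : ∀ j, G.dir j i → ∀ b, MeasurableSet {e | M.value x e j = b}) :
    MeasurableSet {e | M.mechanism x e i = a} := by
  -- The union over parent values is countable: finitely many parents, each with a countable domain.
  have : {e | M.mechanism x e i = a} = ⋃ pa : ∀ j : {j // G.dir j i}, D j,
      (⋂ j : {j // G.dir j i}, {e | M.value x e j.1 = pa j}) ∩
        (fun (e : ∀ k, M.Ω k) (k : M.uses i) => e k.1) ⁻¹' {e | M.f i pa e = a} := by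
    ext e
    simp only [Set.mem_ofPred_eq, Set.mem_iUnion, Set.mem_inter_iff, Set.mem_iInter,
      Set.mem_preimage]
    constructor
    · exact fun he => ⟨fun j => M.value x e j.1, fun _ => rfl, he⟩
    · rintro ⟨pa, hpa, he⟩
      have hpa' : (fun j : {j // G.dir j i} => M.value x e j.1) = pa := funext hpa
      rw [← he, ← hpa']
      rfl
  rw [this]
  refine MeasurableSet.iUnion fun pa => (MeasurableSet.iInter fun j : {j // G.dir j i} => h j.1 j.2 _).inter ?_
  exact measurableSet_preimage (measurable_pi_lambda _ fun k => measurable_pi_apply _)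
    (M.measurable_f i pa a)

theorem measurableSet_value [∀ i, Countable (D i)] (M : SCM.{u, v, w} G D)
    (x : ∀ i, Option (D i)) (i : N) : ∀ a, MeasurableSet {e | M.value x e i = a} := by
  induction i using G.wellFounded_dir.induction with
  | _ i ih =>
    intro a
    cases hx : x i with
    | some b => simp [value_eq M x _ i, hx]
    | none =>
      have := M.measurableSet_mechanism_of_value x i a ih
      simpa [value_eq M x _ i, hx, mechanism] using this

theorem measurableSet_mechanism [∀ i, Countable (D i)] (M : SCM.{u, v, w} G D)
    (x : ∀ i, Option (D i)) (i : N) (a : D i) : MeasurableSet {e | M.mechanism x e i = a} :=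
  M.measurableSet_mechanism_of_value x i a fun j _ b => M.measurableSet_value x j b

open Classical in
/-- The intervention that sets the variables in `C` to their values in `s`. -/
noncomputable def doSet (C : Set N) (s : ∀ i, D i) (i : N) : Option (D i) :=
  if i ∈ C then some (s i) else none

/-- Setting `C` to the values it takes anyway changes nothing. This trades an event about values,
which propagate through the graph, for conditions on single mechanisms with `C` held fixed, so that
influence no longer passes through `C`. -/
theorem value_mem_agree_iff (M : SCM.{u, v, w} G D) {C S : Set N} (hCS : C ⊆ S) (s : ∀ i, D i)
    (e : ∀ k, M.Ω k) :
    M.value (fun _ => none) e ∈ agree S s ↔ ∀ i ∈ S, M.mechanism (doSet C s) e i = s i := by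
  have hmech : M.value (doSet C s) e = M.value (fun _ => none) e →
      ∀ i, M.mechanism (doSet C s) e i = M.value (fun _ => none) e i := by
    intro h i
    rw [mechanism, h, value_eq M _ e i]
    rfl
  constructor
  · intro h i hi
    rw [hmech _ i, h i hi]
    refine M.value_eq_of_consistent _ e fun j a hj => ?_
    unfold doSet at hj
    split_ifs at hj with hjC
    rw [h j (hCS hjC)]
    exact Option.some.inj hj
  · intro h
    have hval : M.value (doSet C s) e = M.value (fun _ => none) e := by
      funext i
      induction i using G.wellFounded_dir.induction with
      | _ i ih =>
        have hpa : (fun j : {j // G.dir j i} => M.value (doSet C s) e j.1) =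
          fun j : {j // G.dir j i} => M.value (fun _ => none) e j.1 := funext fun j => ih j.1 j.2
        rw [value_eq, value_eq M (fun _ => none), ← hpa]
        by_cases hi : i ∈ C
        · have := h i (hCS hi)
          rw [mechanism] at this
          simp [doSet, hi, this]
        · simp [doSet, hi]
    intro i hi
    rw [← hmech hval i, h i hi]

/-- The mechanisms of a set that is closed under parents outside `C` depend, when `C` is held
fixed, only on the exogenous variables that they use. -/
theorem mechanism_congr (M : SCM.{u, v, w} G D) {C L : Set N} (s : ∀ i, D i)
    (hL : ∀ i ∈ L, ∀ j, G.dir j i → j ∉ C → j ∈ L) {e e' : ∀ k, M.Ω k}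
    (he : ∀ i ∈ L, ∀ k ∈ M.uses i, e k = e' k) :
    ∀ i ∈ L, M.mechanism (doSet C s) e i = M.mechanism (doSet C s) e' i := by
  intro i
  induction i using G.wellFounded_dir.induction with
  | _ i ih =>
    intro hi
    have h₁ : (fun k : M.uses i => e k.1) = fun k : M.uses i => e' k.1 :=
      funext fun k => he i hi k.1 k.2
    have h₂ : (fun j : {j // G.dir j i} => M.value (doSet C s) e j.1) =
        fun j : {j // G.dir j i} => M.value (doSet C s) e' j.1 := by
      funext j
      rw [value_eq, value_eq M _ e']
      by_cases hj : j.1 ∈ C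
      · simp [doSet, hj]
      · have := ih j.1 j.2 (hL i hi j.1 j.2 hj)
        rw [mechanism, mechanism] at this
        rw [this]
    rw [mechanism, mechanism, h₁, h₂]

/-- The global Markov property: d-separation implies conditional independence. -/
theorem prob_mul_prob_of_dSep [∀ i, Countable (D i)] (M : SCM.{u, v, w} G D) {A B C : Set N}
    (hd : G.DSep A B C) (s : ∀ i, D i) :
    M.prob (agree (A ∪ B ∪ C) s) * M.prob (agree C s) =
      M.prob (agree (A ∪ C) s) * M.prob (agree (B ∪ C) s) := by
  obtain ⟨T, hBT, hAT, hbi, hdir⟩ := hd.exists_split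
  set An := G.ancestors (A ∪ B ∪ C) with hAn
  have hsub : A ∪ B ∪ C ⊆ An := CausalGraph.subset_ancestors _
  let E : Set N → Set (∀ k, M.Ω k) := fun S => {e | ∀ i ∈ S, M.mechanism (doSet C s) e i = s i}
  have hEm : ∀ S, MeasurableSet (E S) := fun S => by
    have : E S = ⋂ i : S, {e | M.mechanism (doSet C s) e i = s i} := by
      ext e; simp [E]
    rw [this]
    exact MeasurableSet.iInter fun i => M.measurableSet_mechanism _ _ _
  have hcongr : ∀ {L S : Set N}, S ⊆ L → (∀ i ∈ L, ∀ j, G.dir j i → j ∉ C → j ∈ L) →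
      ∀ {e e' : ∀ k, M.Ω k}, (∀ i ∈ L, ∀ k ∈ M.uses i, e k = e' k) → (e ∈ E S ↔ e' ∈ E S) := by
    intro L S hS hL e e' he
    refine forall₂_congr fun i hi => ?_
    rw [M.mechanism_congr s hL he i (hS hi)]
  -- With `C` fixed, the mechanisms on either side of `T` depend only on parents on the same side.
  -- An exogenous variable used on both sides would force a bidirected edge across `T`.
  have hsplit : ∀ S, C ⊆ S → S ⊆ An →
      M.prob (agree S s) = Measure.pi M.μ (E (S ∩ T)) * Measure.pi M.μ (E (S \ T)) := by
    intro S hCS hS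
    have hE : {e | M.value (fun _ => none) e ∈ agree S s} = E (S ∩ T) ∩ E (S \ T) := by
      ext e
      rw [Set.mem_ofPred_eq, M.value_mem_agree_iff hCS]
      constructor
      · exact fun h => ⟨fun i hi => h i hi.1, fun i hi => h i hi.1⟩
      · intro h i hi
        by_cases hT : i ∈ T
        · exact h.1 i ⟨hi, hT⟩
        · exact h.2 i ⟨hi, hT⟩
    rw [prob, probDo, hE]
    refine Measure.pi_inter_of_dependsOn_compl M.μ {k | ∃ i ∈ An ∩ T, k ∈ M.uses i} (hEm _) (hEm _)
      ?_ ?_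
    · intro e e' h
      refine hcongr (L := An ∩ T) (Set.inter_subset_inter_left _ hS) ?_
        fun i hi k hk => h k ⟨i, hi, hk⟩
      exact fun i hi j hj hjC => ⟨CausalGraph.mem_ancestors_of_dir hj hi.1,
        (hdir j i hj hi.1 hjC).2 hi.2⟩
    · intro e e' h
      refine hcongr (L := An \ T) (Set.sdiff_subset_sdiff_left hS) ?_ fun i hi k hk => h k ?_
      · exact fun i hi j hj hjC => ⟨CausalGraph.mem_ancestors_of_dir hj hi.1,
          fun hT => hi.2 ((hdir j i hj hi.1 hjC).1 hT)⟩
      · rintro ⟨j, hj, hkj⟩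
        have hij : i ≠ j := fun h => hi.2 (h ▸ hj.2)
        exact hi.2 ((hbi i hi.1 j hj.1 (M.shared i j k hij hk hkj)).2 hj.2)
  have hBd : B \ T = ∅ := Set.sdiff_eq_empty.2 hBT
  have hAd : A ∩ T = ∅ := hAT.inter_eq
  rw [hsplit _ Set.subset_union_right hsub,
    hsplit C subset_rfl (Set.subset_union_right.trans hsub),
    hsplit (A ∪ C) Set.subset_union_right
      ((Set.union_subset_union_left C Set.subset_union_left).trans hsub),
    hsplit (B ∪ C) Set.subset_union_right
      ((Set.union_subset_union_left C Set.subset_union_right).trans hsub)]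
  -- Since `B` lies inside `T` and `A` outside, both sides are products of the same four factors.
  simp only [Set.union_inter_distrib_right, Set.union_sdiff_distrib, hBd, hAd, Set.empty_union,
    Set.union_empty]
  ring

end SCM

/-! ### The adjustment criterion and the proper backdoor graph -/

namespace CausalGraph

variable {N : Type u} {G : CausalGraph N} {X Y Z : Set N}

/-- The graph without the directed edges from `X` to `P`. -/
def deleteBetween (G : CausalGraph N) (X P : Set N) : CausalGraph N where
  dir a b := G.dir a b ∧ ¬ (a ∈ X ∧ b ∈ P)
  acyclic a h := G.acyclic a (Relation.TransGen.mono (fun _ _ hab => hab.1) _ _ h)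
  bi := G.bi

theorem Edge.of_deleteBetween {X P : Set N} {k : EdgeKind} {a b : N}
    (h : (G.deleteBetween X P).Edge k a b) : G.Edge k a b := by
  cases k
  · exact h.1
  · exact h.1
  · exact h

theorem notMem_of_reflTransGen_deleteIncoming {a b : N} (ha : a ∉ X)
    (h : Relation.ReflTransGen (G.deleteIncoming X).dir a b) : b ∉ X := by
  cases h with
  | refl => exact ha
  | tail _ h => exact h.2

namespace Walk

/-- A walk in a graph without some edges, as a walk in the whole graph. -/
def ofDeleteBetween {X P : Set N} :
    {a b : N} → (G.deleteBetween X P).Walk a b → G.Walk a b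
  | _, _, nil a => nil a
  | _, _, cons k h p => cons k h.of_deleteBetween p.ofDeleteBetween

theorem tailNodes_ofDeleteBetween {X P : Set N} {a b : N} (p : (G.deleteBetween X P).Walk a b) :
    p.ofDeleteBetween.tailNodes = p.tailNodes := by
  induction p with
  | nil => rfl
  | cons k h p ih => simp [ofDeleteBetween, tailNodes, ih]

theorem IsOpen.ofDeleteBetween {X P C : Set N} {a b : N} {p : (G.deleteBetween X P).Walk a b}
    (hp : p.IsOpen C) : p.ofDeleteBetween.IsOpen C := by
  induction p with
  | nil => trivial
  | cons k h p ih =>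
    cases p with
    | nil => trivial
    | cons k₂ h₂ p =>
      refine ⟨fun hk => ?_, hp.2.1, ih hp.2.2⟩
      obtain ⟨d, hd, hmd⟩ := hp.1 hk
      exact ⟨d, hd, Relation.ReflTransGen.mono (fun _ _ hab => hab.1) _ _ hmd⟩

/-- A path that meets `X` has a proper final part. -/
theorem exists_isProper {C : Set N} {a b : N} (p : G.Walk a b) (hp : p.IsPath)
    (ho : p.IsOpen C) :
    (∀ n ∈ p.nodes, n ∉ X) ∨
      ∃ c ∈ X, ∃ q : G.Walk c b, q.IsPath ∧ q.IsOpen C ∧ q.IsProper X := by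
  induction p with
  | nil a =>
    by_cases ha : a ∈ X
    · exact Or.inr ⟨a, ha, nil a, hp, ho, by simp [IsProper, tailNodes]⟩
    · exact Or.inl (by simpa [nodes, tailNodes] using ha)
  | @cons a m c k h p ih =>
    rcases ih (isPath_cons.1 hp).2 ho.tail with hX | hq
    · by_cases ha : a ∈ X
      · exact Or.inr ⟨a, ha, cons k h p, hp, ho, hX⟩
      · refine Or.inl fun n hn => ?_
        rcases mem_nodes_cons.1 hn with rfl | hn
        · exact ha
        · exact hX n hn
    · exact Or.inr hq

theorem IsCausal.reflTransGen {a b : N} {p : G.Walk a b} (hc : p.IsCausal) (hp : p.IsProper X) :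
    ∀ n ∈ p.nodes, Relation.ReflTransGen (G.deleteIncoming X).dir a n ∧
      Relation.ReflTransGen (G.deleteIncoming X).dir n b := by
  induction p with
  | nil a =>
    simp only [nodes, tailNodes, List.mem_singleton, forall_eq]
    exact ⟨Relation.ReflTransGen.refl, Relation.ReflTransGen.refl⟩
  | @cons a m c k h p ih =>
    obtain ⟨rfl, hc⟩ := hc
    have ih := ih hc fun n hn => hp n (List.mem_cons_of_mem _ hn)
    have ham : (G.deleteIncoming X).dir a m := ⟨h, hp m List.mem_cons_self⟩
    intro n hn
    rcases mem_nodes_cons.1 hn with rfl | hn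
    · exact ⟨Relation.ReflTransGen.refl,
        Relation.ReflTransGen.head ham (ih m (start_mem_nodes p)).2⟩
    · exact ⟨Relation.ReflTransGen.head ham (ih n hn).1, (ih n hn).2⟩

theorem exists_isCausal_mem {a n b : N}
    (h₁ : Relation.ReflTransGen (G.deleteIncoming X).dir a n)
    (h₂ : Relation.ReflTransGen (G.deleteIncoming X).dir n b) :
    ∃ p : G.Walk a b, p.IsCausal ∧ p.IsProper X ∧ n ∈ p.nodes := by
  induction h₁ using Relation.ReflTransGen.head_induction_on with
  | refl =>
    obtain ⟨p, hc, hp, -⟩ := exists_isCausal h₂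
    exact ⟨p, hc, hp, start_mem_nodes p⟩
  | @head a m h _ ih =>
    obtain ⟨p, hc, hp, hn⟩ := ih
    refine ⟨cons EdgeKind.fwd h.1 p, ⟨rfl, hc⟩, ?_, mem_nodes_cons.2 (Or.inr hn)⟩
    intro l hl
    rcases List.mem_cons.1 hl with rfl | hl
    · exact h.2
    · exact hp l hl

end Walk

/-- By acyclicity a directed walk is a path, so two directed pieces can be joined without removing
loops. -/
theorem onProperCausalPath_iff {n : N} :
    G.OnProperCausalPath X Y n ↔
      (∃ a ∈ X, Relation.ReflTransGen (G.deleteIncoming X).dir a n) ∧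
        ∃ b ∈ Y, Relation.ReflTransGen (G.deleteIncoming X).dir n b := by
  constructor
  · rintro ⟨a, ha, b, hb, p, -, hc, hp, hn⟩
    exact ⟨⟨a, ha, (hc.reflTransGen hp n hn).1⟩, ⟨b, hb, (hc.reflTransGen hp n hn).2⟩⟩
  · rintro ⟨⟨a, ha, h₁⟩, b, hb, h₂⟩
    obtain ⟨p, hc, hp, hn⟩ := Walk.exists_isCausal_mem h₁ h₂
    exact ⟨a, ha, b, hb, p, hc.isPath, hc, hp, hn⟩

/-- The nodes outside `X` on proper causal paths from `X` to `Y`. -/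
def properCausalNodes (G : CausalGraph N) (X Y : Set N) : Set N :=
  {n | n ∉ X ∧ G.OnProperCausalPath X Y n}

namespace AdjustmentCriterion

/-- Under the adjustment criterion no directed path leads from a proper causal path back to `X`. -/
theorem reflTransGen_of_isDescendant (h : G.AdjustmentCriterion X Y Z) {c n : N}
    (hc : c ∈ G.properCausalNodes X Y) (hd : G.IsDescendant c n) :
    Relation.ReflTransGen (G.deleteIncoming X).dir c n := by
  obtain ⟨hcX, hcP⟩ := hc
  obtain ⟨-, b, hb, hcb⟩ := onProperCausalPath_iff.1 hcP
  have hZ : ∀ m, Relation.ReflTransGen (G.deleteIncoming X).dir c m → m ∉ Z :=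
    fun m hm hmZ => h.1 c hcX hcP m hmZ hm
  -- Going back up from `m` to `c` and then down to `Y` gives an open path outside `X`. If some such
  -- `m` had a child in `X`, prepending that edge would give an open proper non-causal path,
  -- contrary to the criterion.
  have key : ∀ m, Relation.ReflTransGen (G.deleteIncoming X).dir c m →
      ∃ p : G.Walk m b, p.IsPath ∧ p.IsOpen Z ∧ ∀ l ∈ p.nodes, l ∉ X := by
    intro m hm
    induction hm with
    | refl =>
      obtain ⟨p, h₁, -, h₃⟩ := Walk.exists_isCausal hcb
      exact ⟨p, h₁.isPath, h₁.isOpen fun l hl => hZ l (h₃ l hl),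
        fun l hl => notMem_of_reflTransGen_deleteIncoming hcX (h₃ l hl)⟩
    | @tail m l hm hml ih =>
      obtain ⟨p, h₁, h₂, h₃⟩ := ih
      obtain ⟨q, h₄, h₅, h₆, -⟩ := Walk.exists_isPath_cons (k := EdgeKind.bwd) (h := hml.1) h₁
        (h₂.cons (k := EdgeKind.bwd) hml.1 (fun hk => hk.elim) fun hmZ => (hZ m hm hmZ).elim)
      refine ⟨q, h₄, h₅, fun i hi => ?_⟩
      rcases h₆ i hi with rfl | hi
      · exact hml.2
      · exact h₃ i hi
  induction hd with
  | refl => exact Relation.ReflTransGen.refl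
  | @tail m l _ hml ih =>
    refine ih.tail ⟨hml, fun hl => ?_⟩
    obtain ⟨p, h₁, h₂, h₃⟩ := key m ih
    refine h.2 l hl b hb (Walk.cons EdgeKind.bwd hml p)
      (Walk.isPath_cons.2 ⟨fun hlp => h₃ l hlp hl, h₁⟩) h₃ (fun hp => nomatch hp.1) ?_
    exact h₂.cons (k := EdgeKind.bwd) hml (fun hk => hk.elim) fun hmZ => (hZ m ih hmZ).elim

theorem notMem_of_isDescendant (h : G.AdjustmentCriterion X Y Z) {c n : N}
    (hc : c ∈ G.properCausalNodes X Y) (hd : G.IsDescendant c n) : n ∉ X ∧ n ∉ Z := by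
  have hd' := h.reflTransGen_of_isDescendant hc hd
  exact ⟨notMem_of_reflTransGen_deleteIncoming hc.1 hd', fun hZ => h.1 c hc.1 hc.2 n hZ hd'⟩

/-- Under the adjustment criterion `Z` separates `X` and `Y` in the proper backdoor graph. -/
theorem dSep_deleteBetween (h : G.AdjustmentCriterion X Y Z) (hXY : Disjoint X Y) :
    (G.deleteBetween X (G.properCausalNodes X Y)).DSep X Y Z := by
  intro a ha b hb p hp ho
  obtain hX | ⟨c, hc, q, hq, hqo, hqX⟩ := p.exists_isProper (X := X) hp ho
  · exact hX a (Walk.start_mem_nodes p) ha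
  · have hnodes := q.tailNodes_ofDeleteBetween
    have hproper : q.ofDeleteBetween.IsProper X := by rwa [Walk.IsProper, hnodes]
    have hpath : q.ofDeleteBetween.IsPath := by rwa [Walk.IsPath, Walk.nodes, hnodes]
    refine h.2 c hc b hb q.ofDeleteBetween hpath hproper (fun hcausal => ?_) hqo.ofDeleteBetween
    -- A causal proper path would begin with an edge from `X` to a proper causal node, which is
    -- exactly what was deleted.
    cases q with
    | nil => exact Set.disjoint_left.1 hXY hc hb
    | @cons _ m _ k e q =>
      obtain rfl : k = EdgeKind.fwd := hcausal.1
      exact e.2 ⟨hc, hqX m List.mem_cons_self, c, hc, b, hb, _, hpath, hcausal, hproper,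
        Walk.mem_nodes_cons.2 (Or.inr (Walk.start_mem_nodes _))⟩

end AdjustmentCriterion

end CausalGraph

/-! ### The modified model, and independence of `X` and the counterfactual `Y` -/

namespace SCM

variable {N : Type u} {G : CausalGraph N} {D : N → Type v} {X Y Z : Set N}

open Classical in
/-- The model in which the mechanisms of the nodes in `P` read the constants `s` instead of their
parents in `X`. -/
noncomputable def fixBetween (M : SCM.{u, v, w} G D) (X P : Set N) (s : ∀ i, D i) :
    SCM.{u, v, w} (G.deleteBetween X P) D where
  K := M.K
  fintypeK := M.fintypeK
  Ω := M.Ω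
  measurableSpaceΩ := M.measurableSpaceΩ
  μ := M.μ
  isProbabilityMeasureμ := M.isProbabilityMeasureμ
  uses := M.uses
  shared := M.shared
  f i pa := M.f i fun j => if h : j.1 ∈ X ∧ i ∈ P then s j.1 else pa ⟨j.1, j.2, h⟩
  measurable_f i _ a := M.measurable_f i _ a

variable [Finite N]

/-- Only the mechanisms in `P` are altered, so the change spreads no further than to descendants of
`P`. -/
theorem value_fixBetween (M : SCM.{u, v, w} G D) {X P : Set N} (s : ∀ i, D i)
    (e : ∀ k, M.Ω k) {i : N} (h : ∀ p ∈ P, ¬ G.IsDescendant p i) :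
    (M.fixBetween X P s).value (fun _ => none) e i = M.value (fun _ => none) e i := by
  induction i using G.wellFounded_dir.induction with
  | _ i ih =>
    refine (value_eq (M.fixBetween X P s) _ e i).trans ?_
    rw [value_eq M]
    have hi : i ∉ P := fun hi => h i hi Relation.ReflTransGen.refl
    show M.f i _ _ = M.f i _ _
    congr 1
    funext j
    rw [dif_neg fun hj => hi hj.2]
    exact ih j.1 j.2 fun p hp hpj => h p hp (Relation.ReflTransGen.tail hpj j.2)

/-- The hypothesis `h` passes to parents outside `X`, which permits induction. It also ensures that
a node with a parent in `X` is a proper causal node, so both models feed it the same constant. -/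
theorem value_fixBetween_eq_value_doSet (M : SCM.{u, v, w} G D) (s : ∀ i, D i)
    (e : ∀ k, M.Ω k) {i : N} (hi : i ∉ X)
    (h : ∀ a ∈ X, Relation.ReflTransGen (G.deleteIncoming X).dir a i →
      i ∈ G.properCausalNodes X Y) :
    (M.fixBetween X (G.properCausalNodes X Y) s).value (fun _ => none) e i =
      M.value (doSet X s) e i := by
  induction i using G.wellFounded_dir.induction with
  | _ i ih =>
    refine (value_eq (M.fixBetween X (G.properCausalNodes X Y) s) _ e i).trans ?_
    rw [value_eq M, doSet, if_neg hi]
    show M.f i _ _ = M.f i _ _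
    congr 1
    funext j
    by_cases hj : j.1 ∈ X
    · rw [dif_pos ⟨hj, h j.1 hj (Relation.ReflTransGen.single ⟨j.2, hi⟩)⟩, value_eq M, doSet,
        if_pos hj]
      rfl
    · rw [dif_neg fun hh => hj hh.1]
      refine ih j.1 j.2 hj fun a ha haj => ⟨hj, ?_⟩
      have hji : (G.deleteIncoming X).dir j.1 i := ⟨j.2, hi⟩
      obtain ⟨-, b, hb, hib⟩ := CausalGraph.onProperCausalPath_iff.1 (h a ha (haj.tail hji)).2
      exact CausalGraph.onProperCausalPath_iff.2 ⟨⟨a, ha, haj⟩, b, hb,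
        Relation.ReflTransGen.head hji hib⟩

/-- Under the adjustment criterion, `X` and the counterfactual `Y` under `do(X)` are independent
given `Z`. -/
theorem prob_mul_prob_of_adjustmentCriterion [∀ i, Countable (D i)] (M : SCM.{u, v, w} G D)
    (h : G.AdjustmentCriterion X Y Z) (hXY : Disjoint X Y) (s : ∀ i, D i) :
    M.prob (agree (X ∪ Y ∪ Z) s) * M.prob (agree Z s) = M.prob (agree (X ∪ Z) s) *
      Measure.pi M.μ ({e | M.value (doSet X s) e ∈ agree Y s} ∩
        {e | M.value (fun _ => none) e ∈ agree Z s}) := by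
  have key := (M.fixBetween X (G.properCausalNodes X Y) s).prob_mul_prob_of_dSep
    (h.dSep_deleteBetween hXY) s
  set M' := M.fixBetween X (G.properCausalNodes X Y) s with hM'
  have hX : ∀ e : ∀ k, M.Ω k, M'.value (fun _ => none) e ∈ agree X s ↔
      M.value (fun _ => none) e ∈ agree X s := fun e => forall₂_congr fun i hi => by
    rw [M.value_fixBetween s e fun c hc hd => (h.notMem_of_isDescendant hc hd).1 hi]
  have hZ : ∀ e : ∀ k, M.Ω k, M'.value (fun _ => none) e ∈ agree Z s ↔
      M.value (fun _ => none) e ∈ agree Z s := fun e => forall₂_congr fun i hi => by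
    rw [M.value_fixBetween s e fun c hc hd => (h.notMem_of_isDescendant hc hd).2 hi]
  have hY : ∀ e : ∀ k, M.Ω k, M'.value (fun _ => none) e ∈ agree Y s ↔
      M.value (doSet X s) e ∈ agree Y s := fun e => forall₂_congr fun i hi => by
    have hiX : i ∉ X := Set.disjoint_right.1 hXY hi
    rw [M.value_fixBetween_eq_value_doSet s e hiX fun a ha hai => ⟨hiX,
      CausalGraph.onProperCausalPath_iff.2 ⟨⟨a, ha, hai⟩, i, hi, Relation.ReflTransGen.refl⟩⟩]
  -- Consistency: where `X` already has the prescribed values, the counterfactual `Y` is the actual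
  -- `Y`.
  have hcons : ∀ e : ∀ k, M.Ω k, M.value (fun _ => none) e ∈ agree X s →
      M.value (doSet X s) e = M.value (fun _ => none) e := by
    intro e he
    refine M.value_eq_of_consistent _ e fun i a hi => ?_
    unfold doSet at hi
    split_ifs at hi with hiX
    rw [he i hiX]
    exact Option.some.inj hi
  have h₁ : M'.prob (agree (X ∪ Y ∪ Z) s) = M.prob (agree (X ∪ Y ∪ Z) s) := by
    show Measure.pi M.μ {e | M'.value (fun _ => none) e ∈ agree (X ∪ Y ∪ Z) s} =
      Measure.pi M.μ {e | M.value (fun _ => none) e ∈ agree (X ∪ Y ∪ Z) s}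
    congr 1
    ext e
    simp only [agree_union, Set.mem_ofPred_eq, Set.mem_inter_iff]
    rw [hX, hY, hZ]
    refine and_congr_left fun _ => and_congr_right fun he => ?_
    rw [hcons e he]
  have h₂ : M'.prob (agree Z s) = M.prob (agree Z s) := by
    show Measure.pi M.μ {e | M'.value (fun _ => none) e ∈ agree Z s} =
      Measure.pi M.μ {e | M.value (fun _ => none) e ∈ agree Z s}
    congr 1
    ext e
    exact hZ e
  have h₃ : M'.prob (agree (X ∪ Z) s) = M.prob (agree (X ∪ Z) s) := by
    show Measure.pi M.μ {e | M'.value (fun _ => none) e ∈ agree (X ∪ Z) s} =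
      Measure.pi M.μ {e | M.value (fun _ => none) e ∈ agree (X ∪ Z) s}
    congr 1
    ext e
    simp only [agree_union, Set.mem_ofPred_eq, Set.mem_inter_iff]
    rw [hX, hZ]
  have h₄ : M'.prob (agree (Y ∪ Z) s) =
      Measure.pi M.μ ({e | M.value (doSet X s) e ∈ agree Y s} ∩
        {e | M.value (fun _ => none) e ∈ agree Z s}) := by
    show Measure.pi M.μ {e | M'.value (fun _ => none) e ∈ agree (Y ∪ Z) s} = _
    congr 1
    ext e
    simp only [agree_union, Set.mem_ofPred_eq, Set.mem_inter_iff]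
    rw [hY, hZ]
  rwa [h₁, h₂, h₃, h₄] at key

theorem measurableSet_value_agree [∀ i, Countable (D i)] (M : SCM.{u, v, w} G D)
    (x : ∀ i, Option (D i)) (S : Set N) (s : ∀ i, D i) :
    MeasurableSet {e | M.value x e ∈ agree S s} := by
  have : {e | M.value x e ∈ agree S s} = ⋂ i : S, {e | M.value x e i = s i} := by
    ext e
    simp [agree]
  rw [this]
  exact MeasurableSet.iInter fun i => M.measurableSet_value x _ _

theorem prob_ne_top (M : SCM.{u, v, w} G D) (E : Set (∀ i, D i)) : M.prob E ≠ ⊤ :=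
  measure_ne_top _ _

theorem prob_mono (M : SCM.{u, v, w} G D) {E F : Set (∀ i, D i)} (h : E ⊆ F) :
    M.prob E ≤ M.prob F :=
  measure_mono fun _ he => h he

theorem prob_univ (M : SCM.{u, v, w} G D) : M.prob Set.univ = 1 := by
  simp [prob, probDo]

end SCM

/-! ### Events of an m-graph as partial assignments -/

instance (V : Type u) (Vm : Set V) (D : V → Type) [∀ i, Countable (D i)] (n : V ⊕ Vm) :
    Countable (MVal Vm D n) :=
  match n with
  | Sum.inl v => inferInstanceAs (Countable (D v))
  | Sum.inr _ => inferInstanceAs (Countable Bool)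

namespace MGraph

variable {V : Type u} {Vm : Set V} {D : V → Type}

theorem varEvent_eq_agree {A : Set V} (a : ∀ i : A, D i) (s : ∀ n, MVal Vm D n)
    (h : ∀ i : A, s (Sum.inl i.1) = a i) : varEvent Vm a = SCM.agree (varNodes Vm A) s := by
  ext t
  constructor
  · rintro ht _ ⟨v, hv, rfl⟩
    exact (ht ⟨v, hv⟩).trans (h ⟨v, hv⟩).symm
  · exact fun ht i => (ht _ ⟨i.1, i.2, rfl⟩).trans (h i)

theorem indEvent_eq_agree {W : Set V} (s : ∀ n, MVal Vm D n)
    (h : ∀ r : Vm, s (Sum.inr r) = true) : indEvent Vm D W = SCM.agree (indNodes Vm W) s := by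
  ext t
  constructor
  · rintro ht _ ⟨r, hr, rfl⟩
    exact (ht r hr).trans (h r).symm
  · exact fun ht r hr => (ht _ ⟨r, hr, rfl⟩).trans (h r)

theorem doVar_eq_doSet {A : Set V} (a : ∀ i : A, D i) (s : ∀ n, MVal Vm D n)
    (h : ∀ i : A, s (Sum.inl i.1) = a i) : doVar Vm a = SCM.doSet (varNodes Vm A) s := by
  funext n
  cases n with
  | inl v =>
    by_cases hv : v ∈ A
    · have hv' : (Sum.inl v : V ⊕ Vm) ∈ varNodes Vm A := ⟨v, hv, rfl⟩
      simp only [doVar, SCM.doSet, dif_pos hv, if_pos hv']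
      exact congrArg some (h ⟨v, hv⟩).symm
    · have hv' : (Sum.inl v : V ⊕ Vm) ∉ varNodes Vm A := by
        rintro ⟨v', hv', h'⟩
        exact hv (Sum.inl.inj h' ▸ hv')
      simp only [doVar, SCM.doSet, dif_neg hv, if_neg hv']
  | inr r =>
    have hr : (Sum.inr r : V ⊕ Vm) ∉ varNodes Vm A := by
      rintro ⟨v, -, h'⟩
      exact nomatch h'
    simp only [doVar, SCM.doSet, if_neg hr]

theorem varNodes_union (A B : Set V) :
    varNodes Vm (A ∪ B) = varNodes Vm A ∪ varNodes Vm B := by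
  ext n
  simp only [varNodes, Set.mem_union, Set.mem_ofPred_eq, or_and_right, exists_or]

theorem disjoint_varNodes {A B : Set V} (h : Disjoint A B) :
    Disjoint (varNodes Vm A) (varNodes Vm B) := by
  rw [Set.disjoint_left]
  rintro _ ⟨v, hv, rfl⟩ ⟨v', hv', h'⟩
  obtain rfl : v = v' := Sum.inl.inj h'
  exact Set.disjoint_left.1 h hv hv'

open Classical in
/-- Values of three disjoint sets of variables, together with `R = 1`, extend to an assignment. -/
theorem exists_assignment {X Y Z : Set V} (hXY : Disjoint X Y) (hXZ : Disjoint X Z)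
    (hYZ : Disjoint Y Z) (t : ∀ n, MVal Vm D n) (x : ∀ i : X, D i) (y : ∀ i : Y, D i)
    (z : ∀ i : Z, D i) :
    ∃ s : ∀ n, MVal Vm D n, (∀ i : X, s (Sum.inl i.1) = x i) ∧ (∀ i : Y, s (Sum.inl i.1) = y i) ∧
      (∀ i : Z, s (Sum.inl i.1) = z i) ∧ ∀ r : Vm, s (Sum.inr r) = true := by
  let f : ∀ v, D v := fun v =>
    if h : v ∈ X then x ⟨v, h⟩ else if h : v ∈ Y then y ⟨v, h⟩ else if h : v ∈ Z then z ⟨v, h⟩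
      else t (Sum.inl v)
  refine ⟨fun n => match n with
    | Sum.inl v => f v
    | Sum.inr _ => true, fun i => ?_, fun i => ?_, fun i => ?_, fun _ => rfl⟩
  · exact dif_pos i.2
  · exact (dif_neg (Set.disjoint_right.1 hXY i.2)).trans (dif_pos i.2)
  · exact (dif_neg (Set.disjoint_right.1 hXZ i.2)).trans
      ((dif_neg (Set.disjoint_right.1 hYZ i.2)).trans (dif_pos i.2))

end MGraph

/-! ### The adjustment formula -/

theorem proposition1 {V : Type u} [Finite V] {Vm : Set V} (G : MGraph V Vm) (X Y Z : Set V)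
    (hXY : Disjoint X Y) (hXZ : Disjoint X Z) (hYZ : Disjoint Y Z)
    (ha : G.toCausalGraph.AdjustmentCriterion (MGraph.varNodes Vm X) (MGraph.varNodes Vm Y)
      (MGraph.varNodes Vm Z))
    (hb : G.toCausalGraph.DSep (MGraph.varNodes Vm Y)
      (MGraph.indNodes Vm (Vm ∩ (X ∪ Y ∪ Z))) (MGraph.varNodes Vm (X ∪ Z)))
    (hc : G.toCausalGraph.DSep (MGraph.varNodes Vm Z)
      (MGraph.indNodes Vm (Vm ∩ (X ∪ Y ∪ Z))) ∅) :
    MGraph.IsMAdjustmentSet.{u, w} G X Y Z := by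
  intro D _ M x y hR hpos
  set W := Vm ∩ (X ∪ Y ∪ Z) with hW
  -- A realised assignment supplies values for the variables outside `X`, `Y` and `Z`, whose domains
  -- are not assumed nonempty.
  obtain ⟨e₀⟩ : Nonempty (∀ k, M.Ω k) := nonempty_of_isProbabilityMeasure (Measure.pi M.μ)
  let t := M.value (fun _ => none) e₀
  have hsum : M.probDo (MGraph.doVar Vm x) (MGraph.varEvent Vm y) =
      ∑' z : (∀ i : Z, D i), Measure.pi M.μ
        ({e | M.value (MGraph.doVar Vm x) e ∈ MGraph.varEvent Vm y} ∩
          {e | M.value (fun _ => none) e ∈ MGraph.varEvent Vm z}) := by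
    rw [← measure_iUnion]
    · rw [SCM.probDo, ← Set.inter_iUnion]
      congr 1
      refine (Set.inter_eq_left.2 fun e _ => ?_).symm
      exact Set.mem_iUnion.2 ⟨fun i => M.value (fun _ => none) e (Sum.inl i.1), fun _ => rfl⟩
    · intro z z' hz
      rw [Function.onFun, Set.disjoint_left]
      exact fun e he he' => hz (funext fun i => (he.2 i).symm.trans (he'.2 i))
    · intro z
      obtain ⟨s, hsX, hsY, hsZ, -⟩ := MGraph.exists_assignment hXY hXZ hYZ t x y z
      rw [MGraph.doVar_eq_doSet x s hsX, MGraph.varEvent_eq_agree y s hsY,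
        MGraph.varEvent_eq_agree z s hsZ]
      exact (M.measurableSet_value_agree _ _ _).inter (M.measurableSet_value_agree _ _ _)
  rw [hsum]
  refine tsum_congr fun z => ?_
  obtain ⟨s, hsX, hsY, hsZ, hsR⟩ := MGraph.exists_assignment hXY hXZ hYZ t x y z
  have hpz := hpos z
  have hbP := M.prob_mul_prob_of_dSep hb s
  have hcP := M.prob_mul_prob_of_dSep hc s
  have haP := M.prob_mul_prob_of_adjustmentCriterion ha (MGraph.disjoint_varNodes hXY) s
  simp only [SCM.condProb]
  rw [MGraph.indEvent_eq_agree s hsR] at hR hpz ⊢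
  rw [MGraph.varEvent_eq_agree x s hsX, MGraph.varEvent_eq_agree z s hsZ] at hpz ⊢
  rw [MGraph.doVar_eq_doSet x s hsX, MGraph.varEvent_eq_agree y s hsY]
  rw [MGraph.varNodes_union] at hbP
  simp only [← SCM.agree_union] at hpz ⊢
  set A := MGraph.varNodes Vm X
  set B := MGraph.varNodes Vm Y
  set C := MGraph.varNodes Vm Z
  set R := MGraph.indNodes Vm W
  have hempty : M.prob (SCM.agree ∅ s) = 1 := by
    rw [← M.prob_univ]
    congr 1
    simp [SCM.agree]
  rw [Set.union_empty, Set.union_empty, Set.union_empty, hempty, mul_one] at hcP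
  rw [hcP, ENNReal.mul_div_cancel_right hR (M.prob_ne_top _)]
  -- For a null value `z` both sides vanish, and the positivity hypothesis says nothing.
  by_cases hz : M.prob (SCM.agree C s) = 0
  · rw [hz, mul_zero, ← le_zero_iff, ← hz]
    exact measure_mono Set.inter_subset_right
  have hACR := hpz (by rw [hcP]; exact mul_ne_zero hz hR)
  have hAC : M.prob (SCM.agree (A ∪ C) s) ≠ 0 := fun h0 =>
    hACR (le_zero_iff.1 (h0 ▸ M.prob_mono (by rw [SCM.agree_union (A ∪ C)]
                                              exact Set.inter_subset_left)))
  have e₁ : B ∪ R ∪ (A ∪ C) = B ∪ (A ∪ C ∪ R) := by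
    rw [Set.union_assoc, Set.union_comm R]
  have e₂ : B ∪ (A ∪ C) = A ∪ B ∪ C := by
    rw [← Set.union_assoc, Set.union_comm B]
  rw [e₁, e₂, Set.union_comm R] at hbP
  -- Condition (b) drops `R_W = 1` from the conditional probability of `y`.
  have hratio : M.prob (SCM.agree (B ∪ (A ∪ C ∪ R)) s) / M.prob (SCM.agree (A ∪ C ∪ R) s) =
      M.prob (SCM.agree (A ∪ B ∪ C) s) / M.prob (SCM.agree (A ∪ C) s) := by
    rw [ENNReal.div_eq_div_iff hAC (M.prob_ne_top _) hACR (M.prob_ne_top _), mul_comm, hbP,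
      mul_comm]
  rw [hratio, ← ENNReal.mul_div_right_comm, haP, mul_comm,
    ENNReal.mul_div_cancel_right hAC (M.prob_ne_top _)]
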